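/- Let $G$ be a group generated by a finite subset $S\subseteq G$, and put $S^{\pm1}=(S\cup S^{-1})\setminus\{e\}$. For $n>2$ and $s_1,\dots,s_n\in S^{\pm1}$, say that $s_1\cdots s_n=e$ is a *simple relation* in $S^{\pm1}$ if, for $1\le p\le q\le n$, one has $s_ps_{p+1}\cdots s_q=e$ if and only if $(p,q)=(1,n)$. For $i_0,k,m\in\mathbb N$, the group $G$ is *$(i_0,k,m)$-chordal with respect to $S$* if for every simple relation $s_1\cdots s_n=e$ in $S^{\pm1}$ with $n\ge k$ there exist $i,j$ with $1\le i\le i_0$ and $i<j\le n$, and $s'_1,\dots,s'_r\in S^{\pm1}$, such that $s_i\cdots s_j=s'_1\cdots s'_r$ and $r\le\min\{m,\;j-i,\;n-j+i-2\}$. A connected graph is regarded as a metric space with its length metric, every edge being isometric to $[0,1]$. A map $f:(X,d_X)\to(Y,d_Y)$ is a *quasi-isometric embedding* if there are $a,b>0$ with $\frac1a d_X(x,y)-b\le d_Y(f(x),f(y))\le a\,d_X(x,y)+b$ for all $x,y\in X$; it is a *quasi-isometry* if moreover there is a quasi-isometric embedding $g:Y\to X$ such that $d_Y(f(g(y)),y)$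 and $d_X(g(f(x)),x)$ are bounded uniformly in $y\in Y$ and $x\in X$. The group $G$ is *quasi-isometric to a tree* if there is a quasi-isometry from the Cayley graph of $G$ with respect to some finite generating set to a tree (a connected graph without cycles). **Corollary.** $G$ is quasi-isometric to a tree if and only if $G$ is $(i_0,k,m)$-chordal with respect to $S$ for some $i_0,k,m\in\mathbb N$. Moreover, in this case the tree can be chosen to be locally finite. -/

import Mathlib

open scoped Pointwise

universe u v

/-! ### Quasi-isometries -/

/-- `f` is a quasi-isometric embedding: it is an `(a, b)`-quasi-isometric embedding
for some real `a, b > 0`. -/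
def IsQuasiIsometricEmbedding {X Y : Type*} [Dist X] [Dist Y] (f : X → Y) : Prop :=
  ∃ a b : ℝ, 0 < a ∧ 0 < b ∧ ∀ x y : X,
    1 / a * dist x y - b ≤ dist (f x) (f y) ∧ dist (f x) (f y) ≤ a * dist x y + b

/-- The maps `f` and `g` are at finite distance. -/
def AtFiniteDistance {X Y : Type*} [Dist Y] (f g : X → Y) : Prop :=
  ∃ ε : ℝ, 0 < ε ∧ ∀ x : X, dist (f x) (g x) < ε

/-- `f` is a quasi-isometry: a quasi-isometric embedding that has a quasi-inverse. -/
def IsQuasiIsometry {X Y : Type*} [Dist X] [Dist Y] (f : X → Y) : Prop :=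
  IsQuasiIsometricEmbedding f ∧
    ∃ g : Y → X, IsQuasiIsometricEmbedding g ∧
      AtFiniteDistance (f ∘ g) id ∧ AtFiniteDistance (g ∘ f) id

/-- There is a quasi-isometry from `X` to `Y`. -/
def QuasiIsometric (X Y : Type*) [Dist X] [Dist Y] : Prop :=
  ∃ f : X → Y, IsQuasiIsometry f

/-! ### Graphs as metric spaces -/

/-- The point set of a simple graph in which every edge is a copy of the unit interval.
A point is given by its barycentric coordinates: a vertex `x` is `Finsupp.single x 1`, and the
edge joining `x` and `y` is the segment between the two vertices. The case `x = y` is there for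
the vertices of a graph without edges. -/
def GraphSpace {V : Type*} (Γ : SimpleGraph V) : Type _ :=
  {p : V →₀ ℝ // ∃ x y : V, (x = y ∨ Γ.Adj x y) ∧
    p ∈ segment ℝ (Finsupp.single x (1 : ℝ)) (Finsupp.single y 1)}

/-- The lengths of the candidates for a shortest path from `p` to `q`: the direct one, if `p` and
`q` lie on a common edge, and those that run from `p` along its edge to an end `x` of it, then along
edges to an end `y` of the edge of `q`, and then along that edge to `q`. A point `p` on an edge is
at distance `1 - p x` from the end `x` of that edge. -/
def GraphSpace.routeLengths {V : Type*} {Γ : SimpleGraph V} (p q : GraphSpace Γ) : Set ℝ :=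
  {r | ∃ x y : V, (x = y ∨ Γ.Adj x y) ∧
      p.1 ∈ segment ℝ (Finsupp.single x (1 : ℝ)) (Finsupp.single y 1) ∧
      q.1 ∈ segment ℝ (Finsupp.single x (1 : ℝ)) (Finsupp.single y 1) ∧
      r = |p.1 x - q.1 x|} ∪
  {r | ∃ x ∈ p.1.support, ∃ y ∈ q.1.support,
      r = (1 - p.1 x) + (Γ.dist x y : ℝ) + (1 - q.1 y)}

/-- The length metric of a connected graph, with all edges of length one. -/
noncomputable instance GraphSpace.instDist {V : Type*} (Γ : SimpleGraph V) :
    Dist (GraphSpace Γ) where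
  dist p q := sInf (GraphSpace.routeLengths p q)

/-! ### Groups -/

/-- The group `G` is quasi-isometric to `X`: the Cayley graph of `G` with respect to some finite
generating set is quasi-isometric to `X`. -/
def GroupQuasiIsometric (G : Type*) [Group G] (X : Type*) [Dist X] : Prop :=
  ∃ S : Set G, S.Finite ∧ Subgroup.closure S = ⊤ ∧
    QuasiIsometric (GraphSpace (SimpleGraph.mulCayley S)) X

/-- The set `S^{±1} = (S ∪ S⁻¹) ∖ {e}`. -/
def symmGenerators {G : Type*} [Group G] (S : Set G) : Set G := (S ∪ S⁻¹) \ {1}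

/-- The product `s_p s_{p+1} ⋯ s_q` of consecutive letters of the word `w = s_1 ⋯ s_n`, for
`1 ≤ p ≤ q ≤ n`. -/
def segmentProd {G : Type*} [Group G] (w : List G) (p q : ℕ) : G :=
  ((w.take q).drop (p - 1)).prod

/-- The word `w = s_1 ⋯ s_n` is a simple relation in `S^{±1}`: `n > 2`, and the only nonempty
subword of consecutive letters with trivial product is `w` itself. -/
def IsSimpleRelation {G : Type*} [Group G] (S : Set G) (w : List G) : Prop :=
  2 < w.length ∧ (∀ s ∈ w, s ∈ symmGenerators S) ∧
    ∀ p q : ℕ, 1 ≤ p → p ≤ q → q ≤ w.length →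
      (segmentProd w p q = 1 ↔ p = 1 ∧ q = w.length)

/-- The group `G` is `(i₀, k, m)`-chordal with respect to `S`. -/
def IsChordal {G : Type*} [Group G] (S : Set G) (i₀ k m : ℕ) : Prop :=
  ∀ w : List G, IsSimpleRelation S w → k ≤ w.length →
    ∃ i j : ℕ, 1 ≤ i ∧ i ≤ i₀ ∧ i < j ∧ j ≤ w.length ∧
      ∃ w' : List G, (∀ s ∈ w', s ∈ symmGenerators S) ∧
        segmentProd w i j = w'.prod ∧
        (w'.length : ℤ) ≤ min (m : ℤ) (min ((j : ℤ) - i) ((w.length : ℤ) - j + i - 2))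

/-! ### The coarse geometry of `GraphSpace` -/

namespace GraphSpace

variable {V : Type*} {Γ : SimpleGraph V}

/-! Every point of `GraphSpace Γ` is close to a vertex, so its metric agrees with the vertex
distance up to an additive 2 (`dist_sub_two_le`, `dist_le_add_two`). The rest is coarse geometry of
the Cayley graph on its vertices, where simple relations become simple cycles and chordality says
that every long simple cycle has a chord of length at most `m`, shorter than both arcs it cuts off
and starting near the base point of the cycle.

From chordality to a tree: call two vertices on a sphere about the identity equivalent if a walk
outside the open ball joins them. The classes form a rooted tree, with parent given by one step
towards the root. The quotient map is a quasi-isometry as soon as the classes have bounded diameter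
(`exists_tree_quasiIsometric`). If two equivalent vertices were far apart, geodesics to them and a
path outside the ball would form a long simple cycle. Based well below the sphere on one geodesic,
it can only have a chord to the other geodesic, which forces the two vertices to be close
(`dist_le_of_exists_shortcut`).

From a tree to chordality: the image of a closed sequence under a coarse map to a tree must pass a
cut vertex both going out and coming back. The two passages are close in the Cayley graph and give
the chord (`exists_shortcut_of_map_to_tree`). -/

/-- The point of the graph given by a vertex. -/
noncomputable def ofVertex (Γ : SimpleGraph V) (x : V) : GraphSpace Γ :=
  ⟨Finsupp.single x 1, x, x, Or.inl rfl, left_mem_segment ℝ _ _⟩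

lemma exists_support_subset (p : GraphSpace Γ) :
    ∃ x y : V, (x = y ∨ Γ.Adj x y) ∧ ∀ z ∈ p.1.support, z = x ∨ z = y := by
  obtain ⟨p, x, y, hxy, a, b, -, -, -, rfl⟩ := p
  refine ⟨x, y, hxy, fun z hz => ?_⟩
  by_contra! h
  simp [h.1.symm, h.2.symm] at hz

lemma mem_support_of_mem_segment {x y : V} {p : V →₀ ℝ}
    (hp : p ∈ segment ℝ (Finsupp.single x (1 : ℝ)) (Finsupp.single y 1)) :
    x ∈ p.support ∨ y ∈ p.support := by
  classical
  obtain ⟨a, b, ha, hb, hab, rfl⟩ := hp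
  by_contra! h
  by_cases hxy : x = y <;> simp_all

lemma support_nonempty (p : GraphSpace Γ) : ∃ x, x ∈ p.1.support := by
  obtain ⟨x, y, -, hp⟩ := p.2
  rcases mem_support_of_mem_segment hp with h | h
  exacts [⟨_, h⟩, ⟨_, h⟩]

lemma apply_mem_Icc (p : GraphSpace Γ) (z : V) : 0 ≤ p.1 z ∧ p.1 z ≤ 1 := by
  classical
  obtain ⟨p, x, y, -, a, b, ha, hb, hab, rfl⟩ := p
  simp only [Finsupp.add_apply, Finsupp.smul_apply, Finsupp.single_apply, smul_eq_mul]
  split_ifs <;> constructor <;> linarith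

lemma dist_le_one_of_mem_support {p : GraphSpace Γ} {x y : V}
    (hx : x ∈ p.1.support) (hy : y ∈ p.1.support) : Γ.dist x y ≤ 1 := by
  obtain ⟨a, b, hab, h⟩ := p.exists_support_subset
  have key : Γ.dist a b ≤ 1 := by
    rcases hab with rfl | hab
    · simp
    · exact (SimpleGraph.dist_eq_one_iff_adj.2 hab).le
  rcases h x hx with rfl | rfl <;> rcases h y hy with rfl | rfl <;>
    simp_all [SimpleGraph.dist_comm]

/-- Support vertices of one point are at distance at most 1, so replacing the ends of a route by
other support vertices costs at most 1 at each end. The bound also shows that the infimum defining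
`dist` is over a set bounded below. -/
lemma dist_sub_two_le_of_mem_routeLengths (hΓ : Γ.Connected) {p q : GraphSpace Γ} {x y : V}
    (hx : x ∈ p.1.support) (hy : y ∈ q.1.support) {r : ℝ} (hr : r ∈ routeLengths p q) :
    (Γ.dist x y : ℝ) - 2 ≤ r := by
  rcases hr with ⟨a, b, hab, hp, hq, rfl⟩ | ⟨a, ha, b, hb, rfl⟩
  · have key : ∀ z, z = a ∨ z = b → ∀ w, w = a ∨ w = b → Γ.dist z w ≤ 1 := by
      have : Γ.dist a b ≤ 1 := by
        rcases hab with rfl | hab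
        · simp
        · exact (SimpleGraph.dist_eq_one_iff_adj.2 hab).le
      rintro z (rfl | rfl) w (rfl | rfl) <;> simp_all [SimpleGraph.dist_comm]
    have supp : ∀ {p : V →₀ ℝ} {z},
        p ∈ segment ℝ (Finsupp.single a (1 : ℝ)) (Finsupp.single b 1) → z ∈ p.support →
        z = a ∨ z = b := by
      rintro p z ⟨s, t, -, -, -, rfl⟩ hz
      by_contra! h
      simp [h.1.symm, h.2.symm] at hz
    have h1 : (Γ.dist x y : ℝ) ≤ 1 := by
      exact_mod_cast key x (supp hp hx) y (supp hq hy)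
    have := abs_nonneg (p.1 a - q.1 a)
    linarith
  · have h1 : (Γ.dist x y : ℝ) ≤ 1 + Γ.dist a b + 1 := by
      have h1 := hΓ.dist_triangle (u := x) (v := a) (w := y)
      have h2 := hΓ.dist_triangle (u := a) (v := b) (w := y)
      have h3 := dist_le_one_of_mem_support hx ha
      have h4 := dist_le_one_of_mem_support hb hy
      exact_mod_cast (by omega : Γ.dist x y ≤ 1 + Γ.dist a b + 1)
    have := (p.apply_mem_Icc a).2
    have := (q.apply_mem_Icc b).2
    linarith

lemma dist_sub_two_le (hΓ : Γ.Connected) {p q : GraphSpace Γ} {x y : V}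
    (hx : x ∈ p.1.support) (hy : y ∈ q.1.support) :
    (Γ.dist x y : ℝ) - 2 ≤ dist p q :=
  le_csInf ⟨_, Or.inr ⟨x, hx, y, hy, rfl⟩⟩ fun _ hr =>
    dist_sub_two_le_of_mem_routeLengths hΓ hx hy hr

lemma dist_le_add_two {p q : GraphSpace Γ} (hΓ : Γ.Connected) {x y : V}
    (hx : x ∈ p.1.support) (hy : y ∈ q.1.support) :
    dist p q ≤ Γ.dist x y + 2 := by
  refine (csInf_le ⟨(Γ.dist x y : ℝ) - 2, fun _ hr =>
    dist_sub_two_le_of_mem_routeLengths hΓ hx hy hr⟩ (Or.inr ⟨x, hx, y, hy, rfl⟩)).trans ?_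
  have := (p.apply_mem_Icc x).1
  have := (q.apply_mem_Icc y).1
  linarith

/-- An end of an edge that contains the given point. -/
noncomputable def nearVertex (p : GraphSpace Γ) : V := p.support_nonempty.choose

lemma nearVertex_mem_support (p : GraphSpace Γ) : p.nearVertex ∈ p.1.support :=
  p.support_nonempty.choose_spec

@[simp] lemma nearVertex_ofVertex (x : V) : (ofVertex Γ x).nearVertex = x := by
  have h := (ofVertex Γ x).nearVertex_mem_support
  by_contra hne
  rw [Finsupp.mem_support_iff] at h
  exact h (Finsupp.single_eq_of_ne hne)

lemma dist_nearVertex_sub_two_le (hΓ : Γ.Connected) (p q : GraphSpace Γ) :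
    (Γ.dist p.nearVertex q.nearVertex : ℝ) - 2 ≤ dist p q :=
  dist_sub_two_le hΓ p.nearVertex_mem_support q.nearVertex_mem_support

lemma dist_le_dist_nearVertex_add_two (hΓ : Γ.Connected) (p q : GraphSpace Γ) :
    dist p q ≤ Γ.dist p.nearVertex q.nearVertex + 2 :=
  dist_le_add_two hΓ p.nearVertex_mem_support q.nearVertex_mem_support

/-- A quasi-isometric embedding of connected graphs is coarsely given by a map of the vertices. -/
lemma exists_vertex_map {W : Type*} {Λ : SimpleGraph W} (hΓ : Γ.Connected) (hΛ : Λ.Connected)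
    {f : GraphSpace Γ → GraphSpace Λ} (hf : IsQuasiIsometricEmbedding f) :
    ∃ (F : V → W) (D A B : ℕ), (∀ x y, Γ.Adj x y → Λ.dist (F x) (F y) ≤ D) ∧
      ∀ x y, Γ.dist x y ≤ A * Λ.dist (F x) (F y) + B := by
  obtain ⟨a, b, ha, hb, h⟩ := hf
  -- Adjacent vertices are at most 1 + 2 apart in `GraphSpace Γ`, whence `a * 3 + b`; each passage
  -- between points and near vertices costs a further 2.
  refine ⟨fun x => (f (ofVertex Γ x)).nearVertex, ⌈a * 3 + b + 2⌉₊, ⌈a⌉₊,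
    ⌈a * (2 + b) + 2⌉₊, fun x y hxy => ?_, fun x y => ?_⟩
  · have h1 := dist_nearVertex_sub_two_le hΛ (f (ofVertex Γ x)) (f (ofVertex Γ y))
    have h2 := (h (ofVertex Γ x) (ofVertex Γ y)).2
    have h3 := dist_le_dist_nearVertex_add_two hΓ (ofVertex Γ x) (ofVertex Γ y)
    rw [nearVertex_ofVertex, nearVertex_ofVertex, SimpleGraph.dist_eq_one_iff_adj.2 hxy] at h3
    have h4 : a * dist (ofVertex Γ x) (ofVertex Γ y) ≤ a * 3 :=
      mul_le_mul_of_nonneg_left (h3.trans (by norm_num)) ha.le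
    have h5 := Nat.le_ceil (a * 3 + b + 2)
    refine Nat.cast_le (α := ℝ).1 ?_
    push_cast at h3 h4 ⊢
    linarith
  · have h1 := dist_le_dist_nearVertex_add_two hΛ (f (ofVertex Γ x)) (f (ofVertex Γ y))
    have h2 := (h (ofVertex Γ x) (ofVertex Γ y)).1
    have h3 := dist_nearVertex_sub_two_le hΓ (ofVertex Γ x) (ofVertex Γ y)
    rw [nearVertex_ofVertex, nearVertex_ofVertex] at h3
    have h4 : dist (ofVertex Γ x) (ofVertex Γ y) ≤
        a * (Λ.dist (f (ofVertex Γ x)).nearVertex (f (ofVertex Γ y)).nearVertex + 2 + b) := by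
      rw [one_div] at h2
      exact (inv_mul_le_iff₀ ha).1 (by linarith)
    have h5 := Nat.le_ceil (a * (2 + b) + 2)
    have h6 := mul_le_mul_of_nonneg_right (Nat.le_ceil a) (Nat.cast_nonneg (α := ℝ)
      (Λ.dist (f (ofVertex Γ x)).nearVertex (f (ofVertex Γ y)).nearVertex))
    refine Nat.cast_le (α := ℝ).1 ?_
    push_cast
    linarith

/-- A surjective map of the vertices that preserves distances up to an additive constant gives
a quasi-isometry. -/
lemma quasiIsometric_of_surjective {W : Type*} {Λ : SimpleGraph W} (hΓ : Γ.Connected)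
    (hΛ : Λ.Connected) {F : V → W} (hF : F.Surjective) {K : ℕ}
    (h1 : ∀ x y, Λ.dist (F x) (F y) ≤ Γ.dist x y)
    (h2 : ∀ x y, Γ.dist x y ≤ Λ.dist (F x) (F y) + K) :
    QuasiIsometric (GraphSpace Γ) (GraphSpace Λ) := by
  obtain ⟨G, hG⟩ := hF.hasRightInverse
  -- The 4 in `K + 4` is an error of 2 in each of the two graphs. A section `G` of `F` gives the
  -- quasi-inverse: `F ∘ G` is the identity and `G ∘ F` moves vertices by at most `K`.
  refine ⟨fun p => ofVertex Λ (F p.nearVertex), ⟨1, K + 4, one_pos, by positivity, fun p q => ?_⟩,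
    fun p => ofVertex Γ (G p.nearVertex), ⟨1, K + 4, one_pos, by positivity, fun p q => ?_⟩,
    ⟨3, by norm_num, fun p => ?_⟩, K + 3, by positivity, fun p => ?_⟩
  · have a1 := dist_nearVertex_sub_two_le hΓ p q
    have a2 := dist_le_dist_nearVertex_add_two hΓ p q
    have a3 := dist_nearVertex_sub_two_le hΛ (ofVertex Λ (F p.nearVertex))
      (ofVertex Λ (F q.nearVertex))
    have a4 := dist_le_dist_nearVertex_add_two hΛ (ofVertex Λ (F p.nearVertex))
      (ofVertex Λ (F q.nearVertex))
    rw [nearVertex_ofVertex, nearVertex_ofVertex] at a3 a4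
    have a5 : (Λ.dist (F p.nearVertex) (F q.nearVertex) : ℝ) ≤
      Γ.dist p.nearVertex q.nearVertex := by exact_mod_cast h1 _ _
    have a6 : (Γ.dist p.nearVertex q.nearVertex : ℝ) ≤
      Λ.dist (F p.nearVertex) (F q.nearVertex) + K := by exact_mod_cast h2 _ _
    have a7 : (0 : ℝ) ≤ K := K.cast_nonneg
    constructor <;> linarith
  · have a1 := dist_nearVertex_sub_two_le hΛ p q
    have a2 := dist_le_dist_nearVertex_add_two hΛ p q
    have a3 := dist_nearVertex_sub_two_le hΓ (ofVertex Γ (G p.nearVertex))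
      (ofVertex Γ (G q.nearVertex))
    have a4 := dist_le_dist_nearVertex_add_two hΓ (ofVertex Γ (G p.nearVertex))
      (ofVertex Γ (G q.nearVertex))
    rw [nearVertex_ofVertex, nearVertex_ofVertex] at a3 a4
    have b1 := h1 (G p.nearVertex) (G q.nearVertex)
    have b2 := h2 (G p.nearVertex) (G q.nearVertex)
    rw [hG, hG] at b1 b2
    have a5 : (Λ.dist p.nearVertex q.nearVertex : ℝ) ≤
      Γ.dist (G p.nearVertex) (G q.nearVertex) := by exact_mod_cast b1
    have a6 : (Γ.dist (G p.nearVertex) (G q.nearVertex) : ℝ) ≤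
      Λ.dist p.nearVertex q.nearVertex + K := by exact_mod_cast b2
    have a7 : (0 : ℝ) ≤ K := K.cast_nonneg
    constructor <;> linarith
  · have a1 := dist_le_dist_nearVertex_add_two hΛ
      (ofVertex Λ (F (ofVertex Γ (G p.nearVertex)).nearVertex)) p
    rw [nearVertex_ofVertex, nearVertex_ofVertex, hG, SimpleGraph.dist_self] at a1
    simp only [Function.comp_apply, nearVertex_ofVertex, id] at a1 ⊢
    rw [hG]
    norm_num at a1
    linarith
  · have a1 := dist_le_dist_nearVertex_add_two hΓ
      (ofVertex Γ (G (ofVertex Λ (F p.nearVertex)).nearVertex)) p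
    have a2 := h2 (G (F p.nearVertex)) p.nearVertex
    rw [hG, SimpleGraph.dist_self, zero_add] at a2
    have a3 : (Γ.dist (G (F p.nearVertex)) p.nearVertex : ℝ) ≤ K := by exact_mod_cast a2
    simp only [Function.comp_apply, nearVertex_ofVertex, id] at a1 ⊢
    linarith

end GraphSpace

/-! ### Trees given by parent maps -/

namespace SimpleGraph

lemma dist_le_mul_of_adj {V W : Type*} {Γ : SimpleGraph V} {Λ : SimpleGraph W} (hΓ : Γ.Connected)
    (hΛ : Λ.Connected) (F : V → W) {D : ℕ} (h : ∀ x y, Γ.Adj x y → Λ.dist (F x) (F y) ≤ D)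
    (x y : V) : Λ.dist (F x) (F y) ≤ D * Γ.dist x y := by
  obtain ⟨w, hw⟩ := hΓ.exists_walk_length_eq_dist x y
  rw [← hw]
  clear hw
  induction w with
  | nil => simp
  | @cons a b c hab w ih =>
    have := hΛ.dist_triangle (u := F a) (v := F b) (w := F c)
    have := h a b hab
    rw [Walk.length_cons, mul_add]
    omega

/-- The graph in which every vertex is joined to its parent. -/
def parentGraph {V : Type*} (p : V → V) : SimpleGraph V := fromRel fun a b => p a = b

section ParentGraph

variable {V : Type*} {p : V → V} {r : V} {h : V → ℕ}

lemma parentGraph_adj {a b : V} : (parentGraph p).Adj a b ↔ a ≠ b ∧ (p a = b ∨ p b = a) := by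
  simp [parentGraph]

lemma parentGraph_reachable_parent (a : V) : (parentGraph p).Reachable a (p a) := by
  by_cases ha : a = p a
  · rw [← ha]
  · exact (parentGraph_adj.2 ⟨ha, Or.inl rfl⟩).reachable

lemma parentGraph_connected (hr : ∀ a, h a = 0 → a = r) (hp : ∀ a, h (p a) = h a - 1) :
    (parentGraph p).Connected := by
  have key : ∀ n a, h a = n → (parentGraph p).Reachable a r := by
    intro n
    induction n with
    | zero => intro a ha; rw [hr a ha]
    | succ n ih =>
      intro a ha
      exact (parentGraph_reachable_parent a).trans (ih _ (by rw [hp]; omega))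
  have : Nonempty V := ⟨r⟩
  exact ⟨fun a b => (key _ a rfl).trans (key _ b rfl).symm⟩

lemma height_iterate (hp : ∀ a, h (p a) = h a - 1) (k : ℕ) (a : V) : h (p^[k] a) ≤ h a := by
  induction k generalizing a with
  | zero => exact le_rfl
  | succ k ih =>
    rw [Function.iterate_succ_apply]
    exact (ih _).trans (by rw [hp]; omega)

/-- Each edge from `a` to `p a` is a bridge: once it is deleted, the descendants of `a` are closed
under adjacency, and `p a`, having smaller height, is not one of them. -/
lemma parentGraph_isTree (hr : ∀ a, h a = 0 → a = r) (hp : ∀ a, h (p a) = h a - 1) :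
    (parentGraph p).IsTree := by
  refine ⟨parentGraph_connected hr hp, isAcyclic_iff_forall_adj_isBridge.2 ?_⟩
  have bridge : ∀ a, a ≠ p a → (parentGraph p).IsBridge s(a, p a) := by
    intro a ha
    rw [isBridge_iff]
    have hpos : h a ≠ 0 := by
      intro h0
      refine ha ((hr a h0).trans (hr _ ?_).symm)
      rw [hp, h0]
    rintro ⟨w⟩
    have key : ∀ {x y} (w : ((parentGraph p).deleteEdges {s(a, p a)}).Walk x y),
        (∃ k, p^[k] x = a) → ∃ k, p^[k] y = a := by
      intro x y w
      induction w with
      | nil => exact id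
      | @cons x y z hxy w ih =>
        rintro ⟨k, hk⟩
        refine ih ?_
        rw [deleteEdges_adj, parentGraph_adj] at hxy
        obtain ⟨⟨hne, h1 | h1⟩, h2⟩ := hxy
        · cases k with
          | zero =>
            subst h1
            obtain rfl : x = a := hk
            exact absurd rfl h2
          | succ k => exact ⟨k, by rw [← h1, ← Function.iterate_succ_apply, hk]⟩
        · exact ⟨k + 1, by rw [Function.iterate_succ_apply, h1, hk]⟩
    obtain ⟨k, hk⟩ := key w ⟨0, rfl⟩
    have h1 := height_iterate hp k (p a)
    rw [hk, hp] at h1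
    omega
  intro a b hab
  obtain ⟨hne, rfl | rfl⟩ := parentGraph_adj.1 hab
  · exact bridge a hne
  · rw [Sym2.eq_swap]
    exact bridge b hne.symm

/-- A walk between two vertices is at least as long as some climb from both ends to a common
ancestor. Prepending a step to the parent lengthens the climb by one; prepending a step from the
parent to a child cancels the first upward move or extends the climb from the other end. -/
lemma exists_common_ancestor {a b : V} (w : (parentGraph p).Walk a b) :
    ∃ i j, i + j ≤ w.length ∧ p^[i] a = p^[j] b := by
  induction w with
  | nil => exact ⟨0, 0, le_rfl, rfl⟩
  | @cons a a' b hab w ih =>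
    obtain ⟨i, j, hij, h1⟩ := ih
    rw [Walk.length_cons]
    obtain ⟨-, h2 | h2⟩ := parentGraph_adj.1 hab
    · exact ⟨i + 1, j, by omega, by rw [Function.iterate_succ_apply, h2, h1]⟩
    · cases i with
      | zero =>
        exact ⟨0, j + 1, by omega, by
          rw [Function.iterate_succ_apply', ← h1]; exact h2.symm⟩
      | succ i => exact ⟨i, j, by omega, by rw [← h1, Function.iterate_succ_apply, h2]⟩

end ParentGraph

/-! ### The tree of components outside balls -/

section ComponentTree

variable {V : Type*} {Γ : SimpleGraph V} (hΓ : Γ.Connected) (o : V)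

include hΓ in
lemma dist_root_le_add_dist (x y : V) : Γ.dist o y ≤ Γ.dist o x + Γ.dist x y :=
  hΓ.dist_triangle

include hΓ in
lemma exists_adj_closer (x : V) (hx : Γ.dist o x ≠ 0) :
    ∃ y, Γ.Adj x y ∧ Γ.dist o y + 1 = Γ.dist o x := by
  obtain ⟨w, hw⟩ := hΓ.exists_walk_length_eq_dist x o
  rw [dist_comm] at hw
  cases w with
  | nil => exact absurd dist_self hx
  | @cons _ y _ hxy w =>
    refine ⟨y, hxy, ?_⟩
    rw [Walk.length_cons] at hw
    have h1 := dist_le w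
    have h2 := dist_root_le_add_dist hΓ o y x
    rw [dist_comm] at h1
    rw [dist_eq_one_iff_adj.2 hxy.symm] at h2
    omega

open Classical in
/-- A neighbour of `x` that is closer to `o`. -/
noncomputable def closer (hΓ : Γ.Connected) (o x : V) : V :=
  -- The root is its own parent, so the truncated formula in `dist_closer` holds at the root too.
  if hx : Γ.dist o x ≠ 0 then (exists_adj_closer hΓ o x hx).choose else x

lemma dist_closer (x : V) : Γ.dist o (closer hΓ o x) = Γ.dist o x - 1 := by
  unfold closer
  split_ifs with hx
  · have := (exists_adj_closer hΓ o x hx).choose_spec.2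
    omega
  · omega

lemma adj_closer {x : V} (hx : Γ.dist o x ≠ 0) : Γ.Adj x (closer hΓ o x) := by
  unfold closer
  rw [dif_pos hx]
  exact (exists_adj_closer hΓ o x hx).choose_spec.1

lemma dist_self_closer_le (x : V) : Γ.dist x (closer hΓ o x) ≤ 1 := by
  by_cases hx : Γ.dist o x = 0
  · simp [closer, hx]
  · exact (dist_eq_one_iff_adj.2 (adj_closer hΓ o hx)).le

lemma dist_self_iterate_closer_le (i : ℕ) (x : V) : Γ.dist x ((closer hΓ o)^[i] x) ≤ i := by
  induction i with
  | zero => simp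
  | succ i ih =>
    rw [Function.iterate_succ_apply']
    have := hΓ.dist_triangle (u := x) (v := (closer hΓ o)^[i] x)
      (w := closer hΓ o ((closer hΓ o)^[i] x))
    have := dist_self_closer_le hΓ o ((closer hΓ o)^[i] x)
    omega

/-- There is a walk that joins `x` and `y` and stays outside the open ball of radius `n` about `o`. -/
def JoinedOutside (Γ : SimpleGraph V) (o : V) (n : ℕ) (x y : V) : Prop :=
  ∃ w : Γ.Walk x y, ∀ z ∈ w.support, n ≤ Γ.dist o z

variable {o} in
lemma JoinedOutside.symm {n : ℕ} {x y : V} (h : Γ.JoinedOutside o n x y) :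
    Γ.JoinedOutside o n y x := by
  obtain ⟨w, hw⟩ := h
  exact ⟨w.reverse, fun z hz => hw z (by simpa using hz)⟩

variable {o} in
lemma JoinedOutside.trans {n : ℕ} {x y z : V} (h : Γ.JoinedOutside o n x y)
    (h' : Γ.JoinedOutside o n y z) : Γ.JoinedOutside o n x z := by
  obtain ⟨w, hw⟩ := h
  obtain ⟨w', hw'⟩ := h'
  refine ⟨w.append w', fun z hz => ?_⟩
  rw [Walk.mem_support_append_iff] at hz
  exact hz.elim (hw z) (hw' z)

variable {o} in
lemma JoinedOutside.mono {n m : ℕ} (hmn : m ≤ n) {x y : V} (h : Γ.JoinedOutside o n x y) :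
    Γ.JoinedOutside o m x y := by
  obtain ⟨w, hw⟩ := h
  exact ⟨w, fun z hz => hmn.trans (hw z hz)⟩

variable {o} in
lemma JoinedOutside.of_adj {n : ℕ} {x y : V} (h : Γ.Adj x y) (hx : n ≤ Γ.dist o x)
    (hy : n ≤ Γ.dist o y) : Γ.JoinedOutside o n x y := by
  refine ⟨h.toWalk, fun z hz => ?_⟩
  simp at hz
  rcases hz with rfl | rfl <;> assumption

lemma joinedOutside_closer (x : V) : Γ.JoinedOutside o (Γ.dist o x - 1) x (closer hΓ o x) := by
  by_cases hx : Γ.dist o x = 0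
  · exact ⟨Walk.nil.copy rfl (by simp [closer, hx]), fun z hz => by omega⟩
  · exact .of_adj (adj_closer hΓ o hx) (by omega) (dist_closer hΓ o x).ge

/-- Two vertices are equivalent if they are at the same distance `n` from `o` and lie in the same
component of the complement of the open ball of radius `n` about `o`. -/
def componentSetoid (Γ : SimpleGraph V) (o : V) : Setoid V where
  r x y := Γ.dist o x = Γ.dist o y ∧ Γ.JoinedOutside o (Γ.dist o x) x y
  iseqv := ⟨fun x => ⟨rfl, Walk.nil, fun z hz => by simp_all⟩,
    fun h => ⟨h.1.symm, h.1 ▸ h.2.symm⟩,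
    fun h h' => ⟨h.1.trans h'.1, h.2.trans (h.1 ▸ h'.2)⟩⟩

/-- The vertices of the tree of components. -/
abbrev ComponentVertex (Γ : SimpleGraph V) (o : V) := Quotient (componentSetoid Γ o)

/-- The parent of a vertex of the tree of components. -/
noncomputable def componentParent (hΓ : Γ.Connected) (o : V) :
    ComponentVertex Γ o → ComponentVertex Γ o :=
  Quotient.map (closer hΓ o) fun x y hxy => by
    refine ⟨by rw [dist_closer, dist_closer, hxy.1], ?_⟩
    rw [dist_closer]
    -- With `n` the common level of `x` and `y`, the lower neighbours are joined through `x` and `y`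
    -- by a walk outside the ball of radius `n - 1`.
    have h1 := joinedOutside_closer hΓ o y
    rw [← hxy.1] at h1
    exact (joinedOutside_closer hΓ o x).symm.trans ((hxy.2.mono (by omega)).trans h1)

/-- The distance from the root in the tree of components. -/
noncomputable def componentHeight (Γ : SimpleGraph V) (o : V) : ComponentVertex Γ o → ℕ :=
  Quotient.lift (Γ.dist o) fun _ _ h => h.1

/-- The tree of components. -/
noncomputable abbrev componentTree (hΓ : Γ.Connected) (o : V) :
    SimpleGraph (ComponentVertex Γ o) :=
  parentGraph (componentParent hΓ o)

lemma componentHeight_parent (a : ComponentVertex Γ o) :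
    componentHeight Γ o (componentParent hΓ o a) = componentHeight Γ o a - 1 := by
  induction a using Quotient.inductionOn with
  | h x => exact dist_closer hΓ o x

include hΓ in
lemma eq_root_of_componentHeight_eq_zero (a : ComponentVertex Γ o)
    (ha : componentHeight Γ o a = 0) : a = Quotient.mk _ o := by
  induction a using Quotient.inductionOn with
  | h x => rw [hΓ.dist_eq_zero_iff.1 (show Γ.dist o x = 0 from ha)]

lemma componentTree_isTree : (componentTree hΓ o).IsTree :=
  parentGraph_isTree (eq_root_of_componentHeight_eq_zero hΓ o) (componentHeight_parent hΓ o)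

lemma mk_iterate_closer (i : ℕ) (x : V) :
    (Quotient.mk _ ((closer hΓ o)^[i] x) : ComponentVertex Γ o) =
      (componentParent hΓ o)^[i] (Quotient.mk _ x) := by
  induction i with
  | zero => rfl
  | succ i ih =>
    rw [Function.iterate_succ_apply', Function.iterate_succ_apply', ← ih]
    rfl

/-- The parent class does not depend on the neighbour chosen by `closer`: any two lower neighbours
of `x` are joined through `x`. -/
lemma mk_eq_componentParent {x y : V} (hxy : Γ.Adj x y) (h : Γ.dist o y + 1 = Γ.dist o x) :
    componentParent hΓ o (Quotient.mk _ x) = Quotient.mk _ y := by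
  refine Quotient.sound ⟨by rw [dist_closer]; omega, ?_⟩
  rw [dist_closer]
  exact (joinedOutside_closer hΓ o x).symm.trans (.of_adj hxy (by omega) (by omega))

lemma componentTree_dist_le_one {x y : V} (hxy : Γ.Adj x y) :
    (componentTree hΓ o).dist (Quotient.mk _ x) (Quotient.mk _ y) ≤ 1 := by
  have key : ∀ a b : ComponentVertex Γ o, componentParent hΓ o a = b →
      (componentTree hΓ o).dist a b ≤ 1 := by
    intro a b hab
    by_cases hne : a = b
    · simp [hne]
    · exact (dist_eq_one_iff_adj.2 (parentGraph_adj.2 ⟨hne, .inl hab⟩)).le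
  have h1 := dist_root_le_add_dist hΓ o x y
  have h2 := dist_root_le_add_dist hΓ o y x
  rw [dist_eq_one_iff_adj.2 hxy] at h1
  rw [dist_eq_one_iff_adj.2 hxy.symm] at h2
  rcases lt_trichotomy (Γ.dist o x) (Γ.dist o y) with h | h | h
  · rw [dist_comm]
    exact key _ _ (mk_eq_componentParent hΓ o hxy.symm (by omega))
  · have : (Quotient.mk _ x : ComponentVertex Γ o) = Quotient.mk _ y :=
      Quotient.sound ⟨h, .of_adj hxy le_rfl h.le⟩
    rw [this, dist_self]
    exact zero_le_one
  · exact key _ _ (mk_eq_componentParent hΓ o hxy (by omega))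

lemma componentTree_dist_le (x y : V) :
    (componentTree hΓ o).dist (Quotient.mk _ x) (Quotient.mk _ y) ≤ Γ.dist x y := by
  simpa using dist_le_mul_of_adj hΓ (componentTree_isTree hΓ o).connected (Quotient.mk _)
    (fun x y => componentTree_dist_le_one hΓ o) x y

/-- The climbs to a common ancestor in the tree lift to equally many `closer` steps in `Γ`. The
lifted climbs end in one class, hence within `K` of each other. -/
lemma dist_le_componentTree_dist_add {K : ℕ}
    (hK : ∀ x y, Γ.dist o x = Γ.dist o y → Γ.JoinedOutside o (Γ.dist o x) x y → Γ.dist x y ≤ K)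
    (x y : V) :
    Γ.dist x y ≤ (componentTree hΓ o).dist (Quotient.mk _ x) (Quotient.mk _ y) + K := by
  obtain ⟨w, hw⟩ := (componentTree_isTree hΓ o).connected.exists_walk_length_eq_dist
    (Quotient.mk _ x) (Quotient.mk _ y)
  obtain ⟨i, j, hij, h⟩ := exists_common_ancestor w
  rw [← mk_iterate_closer, ← mk_iterate_closer] at h
  have h0 := Quotient.exact h
  have h1 := hK _ _ h0.1 h0.2
  have h2 := dist_self_iterate_closer_le hΓ o i x
  have h3 := dist_self_iterate_closer_le hΓ o j y
  have h4 := hΓ.dist_triangle (u := x) (v := (closer hΓ o)^[i] x) (w := y)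
  have h5 := hΓ.dist_triangle (u := (closer hΓ o)^[i] x) (v := (closer hΓ o)^[j] y) (w := y)
  rw [dist_comm (u := (closer hΓ o)^[j] y) (v := y)] at h5
  omega

/-! ### Local finiteness and countability -/

include hΓ in
lemma finite_setOf_dist_le (hfin : ∀ x, (Γ.neighborSet x).Finite) (n : ℕ) :
    {x | Γ.dist o x ≤ n}.Finite := by
  induction n with
  | zero =>
    refine (Set.finite_singleton o).subset fun x hx => ?_
    exact (hΓ.dist_eq_zero_iff.1 (Nat.le_zero.1 hx)).symm
  | succ n ih =>
    refine (ih.union (ih.biUnion fun x _ => hfin x)).subset fun x hx => ?_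
    by_cases h0 : Γ.dist o x = 0
    · exact Or.inl (by simp [h0])
    · refine Or.inr (Set.mem_biUnion (x := closer hΓ o x) ?_ (adj_closer hΓ o h0).symm)
      have := dist_closer hΓ o x
      simp only [Set.mem_ofPred_eq] at hx ⊢
      omega

include hΓ in
lemma countable_of_finite_neighborSet (hfin : ∀ x, (Γ.neighborSet x).Finite) : Countable V := by
  obtain ⟨o⟩ := hΓ.nonempty
  refine Set.countable_univ_iff.1 ((Set.countable_iUnion fun n =>
    (finite_setOf_dist_le hΓ o hfin n).countable).mono fun x _ => ?_)
  exact Set.mem_iUnion.2 ⟨Γ.dist o x, le_refl (Γ.dist o x)⟩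

/-- Neighbours have height at most one more than `a`, so they are classes of vertices in a finite
ball. -/
lemma componentTree_finite_neighborSet (hfin : ∀ x, (Γ.neighborSet x).Finite)
    (a : ComponentVertex Γ o) : ((componentTree hΓ o).neighborSet a).Finite := by
  refine ((finite_setOf_dist_le hΓ o hfin (componentHeight Γ o a + 1)).image
    (Quotient.mk _)).subset fun b hb => ?_
  obtain ⟨-, h⟩ := parentGraph_adj.1 hb
  obtain ⟨x, rfl⟩ := Quotient.exists_rep b
  refine ⟨x, ?_, rfl⟩
  change componentHeight Γ o (Quotient.mk _ x) ≤ _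
  rcases h with h | h
  · have := componentHeight_parent hΓ o a
    rw [h] at this
    omega
  · have := componentHeight_parent hΓ o (Quotient.mk _ x)
    rw [h] at this
    omega

end ComponentTree

/-- A locally finite graph in which the vertices that lie on a common sphere about `o` and in a
common component outside the corresponding ball are uniformly close is quasi-isometric to a
locally finite tree. -/
theorem exists_tree_quasiIsometric {V : Type u} {Γ : SimpleGraph V} (hΓ : Γ.Connected) (o : V)
    (hfin : ∀ x, (Γ.neighborSet x).Finite) {K : ℕ}
    (hK : ∀ x y, Γ.dist o x = Γ.dist o y → Γ.JoinedOutside o (Γ.dist o x) x y → Γ.dist x y ≤ K) :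
    ∃ (T : Type v) (t : SimpleGraph T), t.IsTree ∧ (∀ x : T, (t.neighborSet x).Finite) ∧
      QuasiIsometric (GraphSpace Γ) (GraphSpace t) := by
  -- Countability makes the set of classes small in every universe, so the tree can be copied into
  -- `Type v`.
  have := countable_of_finite_neighborSet hΓ hfin
  let e : Shrink.{v} (ComponentVertex Γ o) ≃ ComponentVertex Γ o := (equivShrink _).symm
  let φ : (componentTree hΓ o).comap e ≃g componentTree hΓ o := Iso.comap e _
  have ht : ((componentTree hΓ o).comap e).IsTree := φ.isTree_iff.2 (componentTree_isTree hΓ o)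
  refine ⟨_, (componentTree hΓ o).comap e, ht, fun x => ?_, ?_⟩
  · refine ((componentTree_finite_neighborSet hΓ o hfin (e x)).preimage e.injective.injOn).subset ?_
    exact fun y hy => hy
  · have hdist : ∀ a b, ((componentTree hΓ o).comap e).dist (e.symm a) (e.symm b) =
        (componentTree hΓ o).dist a b := by
      intro a b
      refine le_antisymm ?_ ?_
      · have := dist_le_mul_of_adj (componentTree_isTree hΓ o).connected ht.connected e.symm
          (D := 1) (fun x y hxy => (dist_eq_one_iff_adj.2 (by simpa using hxy)).le) a b
        simpa using this
      · have := dist_le_mul_of_adj ht.connected (componentTree_isTree hΓ o).connected e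
          (D := 1) (fun x y hxy => (dist_eq_one_iff_adj.2 (φ.map_rel_iff.2 hxy)).le)
          (e.symm a) (e.symm b)
        simpa using this
    refine GraphSpace.quasiIsometric_of_surjective hΓ ht.connected
      (F := fun x => e.symm (Quotient.mk _ x)) (K := K)
      (e.symm.surjective.comp Quotient.mk_surjective) (fun x y => ?_) fun x y => ?_
    · rw [hdist]
      exact componentTree_dist_le hΓ o x y
    · rw [hdist]
      exact dist_le_componentTree_dist_add hΓ o hK x y

end SimpleGraph

/-! ### Words and walks in Cayley graphs -/

section Cayley

variable {G : Type*} [Group G] {S : Set G}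

open SimpleGraph

lemma mulCayley_adj_iff {u v : G} : (mulCayley S).Adj u v ↔ u⁻¹ * v ∈ symmGenerators S := by
  rw [mulCayley_adj, symmGenerators, Set.mem_sdiff, Set.mem_union, Set.mem_inv, mul_inv_rev,
    inv_inv, Set.mem_singleton_iff, inv_mul_eq_one, and_comm]

lemma mulCayley_neighborSet_finite (hfin : S.Finite) (x : G) :
    ((mulCayley S).neighborSet x).Finite := by
  refine (((hfin.union hfin.inv).subset (Set.sdiff_subset (t := {1}))).image (x * ·)).subset
    fun y hy => ?_
  exact ⟨x⁻¹ * y, mulCayley_adj_iff.1 hy, by simp⟩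

lemma mulCayley_connected (hgen : Subgroup.closure S = ⊤) : (mulCayley S).Connected := by
  have step : ∀ x g, g ∈ S → (mulCayley S).Reachable x (x * g) := by
    intro x g hg
    by_cases h : x = x * g
    · rw [← h]
    · exact (show (mulCayley S).Adj x (x * g) from
        (mulCayley_adj _ _ _).2 ⟨h, Or.inl (by simpa)⟩).reachable
  have key : ∀ g : G, ∀ x, (mulCayley S).Reachable x (x * g) := by
    intro g
    have hg : g ∈ Subgroup.closure S := hgen ▸ Subgroup.mem_top g
    induction hg using Subgroup.closure_induction with
    | mem g hg => exact fun x => step x g hg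
    | one => intro x; rw [mul_one]
    | mul a b _ _ iha ihb => intro x; rw [← mul_assoc]; exact (iha x).trans (ihb _)
    | inv a _ iha =>
      intro x
      simpa using (iha (x * a⁻¹)).symm
  exact ⟨fun x y => by simpa using key (x⁻¹ * y) x⟩

lemma exists_walk_of_word (w : List G) (hw : ∀ s ∈ w, s ∈ symmGenerators S) {u v : G}
    (h : u⁻¹ * v = w.prod) : ∃ p : (mulCayley S).Walk u v, p.length = w.length := by
  induction w generalizing u with
  | nil =>
    obtain rfl : u = v := inv_mul_eq_one.1 h
    exact ⟨Walk.nil, rfl⟩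
  | cons s w ih =>
    rw [List.forall_mem_cons] at hw
    obtain ⟨p, hp⟩ := ih hw.2 (u := u * s) (by
      rw [mul_inv_rev, mul_assoc, h, List.prod_cons, inv_mul_cancel_left])
    have hadj : (mulCayley S).Adj u (u * s) := mulCayley_adj_iff.2 (by simpa using hw.1)
    exact ⟨Walk.cons hadj p, by rw [Walk.length_cons, hp, List.length_cons]⟩

lemma mulCayley_dist_le_length (w : List G) (hw : ∀ s ∈ w, s ∈ symmGenerators S) {u v : G}
    (h : u⁻¹ * v = w.prod) : (mulCayley S).dist u v ≤ w.length := by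
  obtain ⟨p, hp⟩ := exists_walk_of_word w hw h
  exact hp ▸ dist_le p

lemma exists_word_of_walk {u v : G} (p : (mulCayley S).Walk u v) :
    ∃ w : List G, (∀ s ∈ w, s ∈ symmGenerators S) ∧ u⁻¹ * v = w.prod ∧ w.length = p.length := by
  induction p with
  | nil => exact ⟨[], by simp, by simp, rfl⟩
  | @cons a b c hab p ih =>
    obtain ⟨w, h1, h2, h3⟩ := ih
    refine ⟨(a⁻¹ * b) :: w, ?_, ?_, ?_⟩
    · exact List.forall_mem_cons.2 ⟨mulCayley_adj_iff.1 hab, h1⟩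
    · rw [List.prod_cons, ← h2]; group
    · rw [List.length_cons, h3, Walk.length_cons]

lemma exists_word_of_dist (hgen : Subgroup.closure S = ⊤) (u v : G) :
    ∃ w : List G, (∀ s ∈ w, s ∈ symmGenerators S) ∧ u⁻¹ * v = w.prod ∧
      w.length = (mulCayley S).dist u v := by
  obtain ⟨p, hp⟩ := (mulCayley_connected hgen).exists_walk_length_eq_dist u v
  exact hp ▸ exists_word_of_walk p

lemma mulCayley_dist_eq_dist_one (hgen : Subgroup.closure S = ⊤) (u v : G) :
    (mulCayley S).dist u v = (mulCayley S).dist 1 (u⁻¹ * v) := by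
  refine le_antisymm ?_ ?_
  · obtain ⟨w, h1, h2, h3⟩ := exists_word_of_dist hgen 1 (u⁻¹ * v)
    rw [← h3]
    exact mulCayley_dist_le_length w h1 (by simpa using h2)
  · obtain ⟨w, h1, h2, h3⟩ := exists_word_of_dist hgen u v
    rw [← h3]
    exact mulCayley_dist_le_length w h1 (by simpa using h2)

/-- Word metrics for finite generating sets are bounded by multiples of each other. -/
lemma exists_mulCayley_dist_le {S' : Set G} (hgen : Subgroup.closure S = ⊤) (hfin : S'.Finite)
    (hgen' : Subgroup.closure S' = ⊤) :
    ∃ C : ℕ, ∀ u v, (mulCayley S).dist u v ≤ C * (mulCayley S').dist u v := by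
  have hf : (symmGenerators S').Finite := (hfin.union hfin.inv).subset Set.sdiff_subset
  obtain ⟨C, hC⟩ := (hf.image fun s => (mulCayley S).dist 1 s).bddAbove
  refine ⟨C, dist_le_mul_of_adj (mulCayley_connected hgen') (mulCayley_connected hgen) id
    fun x y hxy => ?_⟩
  rw [id, id, mulCayley_dist_eq_dist_one hgen]
  exact hC ⟨_, mulCayley_adj_iff.1 hxy, rfl⟩

/-! ### Simple relations as simple cycles -/

lemma segmentProd_eq_inv_mul (w : List G) {p q : ℕ} (hpq : p ≤ q + 1) :
    segmentProd w p q = ((w.take (p - 1)).prod)⁻¹ * (w.take q).prod := by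
  rw [segmentProd, eq_inv_mul_iff_mul_eq]
  conv_rhs => rw [← List.take_append_drop (p - 1) (w.take q), List.prod_append,
    List.take_take, min_eq_left (by omega)]

/-- The word that labels the steps of a sequence of group elements. -/
def stepWord (v : ℕ → G) (n : ℕ) : List G := (List.range n).map fun i => (v i)⁻¹ * v (i + 1)

@[simp] lemma length_stepWord (v : ℕ → G) (n : ℕ) : (stepWord v n).length = n := by
  simp [stepWord]

lemma prod_take_stepWord (v : ℕ → G) {n q : ℕ} (hq : q ≤ n) :
    ((stepWord v n).take q).prod = (v 0)⁻¹ * v q := by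
  have h : ∀ m, (stepWord v m).prod = (v 0)⁻¹ * v m := by
    intro m
    induction m with
    | zero => simp [stepWord]
    | succ m ih =>
      rw [stepWord, List.range_succ, List.map_append, List.prod_append, ← stepWord, ih]
      simp
  rw [← h q, stepWord, ← List.map_take, List.take_range, min_eq_left hq, stepWord]

lemma segmentProd_stepWord (v : ℕ → G) {n p q : ℕ} (hpq : p ≤ q + 1) (hq : q ≤ n) :
    segmentProd (stepWord v n) p q = (v (p - 1))⁻¹ * v q := by
  rw [segmentProd_eq_inv_mul _ hpq, prod_take_stepWord v (by omega), prod_take_stepWord v hq]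
  group

/-- A subword has trivial product exactly when the sequence returns to the vertex where the subword
starts. -/
lemma isSimpleRelation_stepWord {v : ℕ → G} {n : ℕ} (hn : 2 < n)
    (hadj : ∀ i < n, (mulCayley S).Adj (v i) (v (i + 1))) (hclosed : v n = v 0)
    (hinj : ∀ i j, i < j → j < n → v i ≠ v j) : IsSimpleRelation S (stepWord v n) := by
  refine ⟨by simpa, fun s hs => ?_, fun p q hp hpq hq => ?_⟩
  · obtain ⟨i, hi, rfl⟩ := List.mem_map.1 hs
    exact mulCayley_adj_iff.1 (hadj i (List.mem_range.1 hi))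
  · rw [length_stepWord] at hq ⊢
    rw [segmentProd_stepWord v (by omega) hq, inv_mul_eq_one]
    constructor
    · intro h
      by_contra hne
      by_cases hqn : q = n
      · subst hqn
        rw [hclosed] at h
        exact hinj 0 (p - 1) (by omega) (by omega) h.symm
      · exact hinj (p - 1) q (by omega) (by omega) h
    · rintro ⟨rfl, rfl⟩
      exact hclosed.symm

/-- Chordality, in terms of simple cycles in the Cayley graph. -/
lemma IsChordal.exists_shortcut {i₀ k m : ℕ} (hch : IsChordal S i₀ k m) {v : ℕ → G} {n : ℕ}
    (hn : 2 < n) (hk : k ≤ n)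
    (hadj : ∀ i < n, (mulCayley S).Adj (v i) (v (i + 1))) (hclosed : v n = v 0)
    (hinj : ∀ i j, i < j → j < n → v i ≠ v j) :
    ∃ i j d : ℕ, i < i₀ ∧ i + 1 < j ∧ j ≤ n ∧ (mulCayley S).dist (v i) (v j) = d ∧
      d ≤ m ∧ d + i + 1 ≤ j ∧ d + j + 1 ≤ n + i := by
  obtain ⟨i, j, hi1, hi, hij, hj, w', hw', hprod, hr⟩ :=
    hch _ (isSimpleRelation_stepWord hn hadj hclosed hinj) (by simpa)
  rw [length_stepWord] at hj hr
  rw [segmentProd_stepWord v (by omega) hj] at hprod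
  -- The letter numbered `i` starts at the vertex numbered `i - 1`. After this shift the bounds say
  -- that the chord is strictly shorter than both arcs.
  have hd : (mulCayley S).dist (v (i - 1)) (v j) ≤ w'.length :=
    mulCayley_dist_le_length w' hw' hprod
  obtain ⟨i, rfl⟩ : ∃ i', i = i' + 1 := ⟨i - 1, by omega⟩
  simp only [Nat.add_sub_cancel] at hd
  push_cast at hr
  exact ⟨i, j, _, by omega, by omega, hj, rfl, by omega, by omega, by omega⟩

end Cayley

/-! ### Chordality bounds the components of spheres -/

section Chordal

open SimpleGraph

variable {V : Type*} {Γ : SimpleGraph V} (hΓ : Γ.Connected) (o : V)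

lemma SimpleGraph.dist_iterate_closer (i : ℕ) (x : V) :
    Γ.dist o ((closer hΓ o)^[i] x) = Γ.dist o x - i := by
  induction i with
  | zero => rfl
  | succ i ih => rw [Function.iterate_succ_apply', dist_closer, ih, Nat.sub_sub]

include hΓ in
/-- A geodesic from `o` to `x`. -/
lemma SimpleGraph.exists_geodesic (x : V) :
    ∃ a : ℕ → V, a (Γ.dist o x) = x ∧ (∀ i ≤ Γ.dist o x, Γ.dist o (a i) = i) ∧
      (∀ i < Γ.dist o x, Γ.Adj (a i) (a (i + 1))) ∧
      ∀ i ≤ Γ.dist o x, Γ.dist x (a i) ≤ Γ.dist o x - i := by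
  refine ⟨fun i => (closer hΓ o)^[Γ.dist o x - i] x, by simp, fun i hi => ?_, fun i hi => ?_,
    fun i hi => dist_self_iterate_closer_le hΓ o _ x⟩
  · rw [dist_iterate_closer]
    omega
  · have h : Γ.dist o x - i = Γ.dist o x - (i + 1) + 1 := by omega
    simp only [h, Function.iterate_succ_apply']
    refine (adj_closer hΓ o ?_).symm
    rw [dist_iterate_closer]
    omega

include hΓ in
/-- If every long cycle has a short shortcut that starts near a prescribed vertex, then the
vertices on a sphere that are joined outside the ball are uniformly close. -/
lemma SimpleGraph.dist_le_of_exists_shortcut {i₀ k m : ℕ}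
    (hcut : ∀ (v : ℕ → V) (n : ℕ), 2 < n → k ≤ n → (∀ i < n, Γ.Adj (v i) (v (i + 1))) →
      v n = v 0 → (∀ i j, i < j → j < n → v i ≠ v j) →
      ∃ i j d : ℕ, i < i₀ ∧ i + 1 < j ∧ j ≤ n ∧ Γ.dist (v i) (v j) = d ∧
        d ≤ m ∧ d + i + 1 ≤ j ∧ d + j + 1 ≤ n + i)
    (x y : V) (hxy : Γ.dist o x = Γ.dist o y) (hjoin : Γ.JoinedOutside o (Γ.dist o x) x y) :
    Γ.dist x y ≤ 2 * (m + i₀ + k + 3) + 2 * m := by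
  classical
  obtain ⟨a, han, ha, haa, hax⟩ := exists_geodesic hΓ o x
  obtain ⟨b, hbn, hb, hbb, hby⟩ := exists_geodesic hΓ o y
  rw [← hxy] at hbn hb hbb hby
  obtain ⟨w, hw⟩ := hjoin
  generalize hn : Γ.dist o x = n at *
  -- `R` is the depth below the sphere at which the cycle will be based: its first `i₀` vertices
  -- then lie on the geodesic `a`, more than `m` below the sphere, and the cycle has length at least
  -- `k` and more than 2.
  obtain ⟨R, hR⟩ : ∃ R, R = m + i₀ + k + 3 := ⟨_, rfl⟩
  rw [← hR]
  have close : ∀ i j, i ≤ n → j ≤ n → Γ.dist x y ≤ (n - i) + Γ.dist (a i) (b j) + (n - j) := by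
    intro i j hi hj
    have h1 := hΓ.dist_triangle (u := x) (v := a i) (w := y)
    have h2 := hΓ.dist_triangle (u := a i) (v := b j) (w := y)
    have h3 := hax i hi
    have h4 := hby j hj
    rw [dist_comm] at h4
    omega
  have h00 : a 0 = b 0 := by
    rw [← hΓ.dist_eq_zero_iff.1 (ha 0 (Nat.zero_le _)),
      ← hΓ.dist_eq_zero_iff.1 (hb 0 (Nat.zero_le _))]
  by_cases hmeet : ∃ l, n - R ≤ l ∧ l ≤ n ∧ a l = b l
  · obtain ⟨l, h1, h2, h3⟩ := hmeet
    have := close l l h2 h2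
    rw [h3, dist_self] at this
    omega
  push Not at hmeet
  have hRn : R < n := by
    by_contra h
    exact hmeet 0 (by omega) (by omega) h00
  obtain ⟨s, hs⟩ : ∃ s, s + R = n := ⟨n - R, by omega⟩
  -- `l` is the last level at which the geodesics meet; taking the last one makes the cycle simple.
  obtain ⟨l, hls, hl, hlmax⟩ : ∃ l, l < s ∧ a l = b l ∧ ∀ i, l < i → i ≤ n → a i ≠ b i := by
    have h1 : a (Nat.findGreatest (fun i => a i = b i) n) =
        b (Nat.findGreatest (fun i => a i = b i) n) :=
      Nat.findGreatest_spec (P := fun i => a i = b i) (Nat.zero_le n) h00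
    refine ⟨_, ?_, h1, fun i hi hin => Nat.findGreatest_is_greatest hi hin⟩
    by_contra h
    exact hmeet _ (by omega) (Nat.findGreatest_le n) h1
  obtain ⟨q, L, hq0, hqL, hqq, hq, hqinj⟩ : ∃ (q : ℕ → V) (L : ℕ), q 0 = x ∧ q L = y ∧
      (∀ i < L, Γ.Adj (q i) (q (i + 1))) ∧ (∀ i, n ≤ Γ.dist o (q i)) ∧
      ∀ i j, i < j → j ≤ L → q i ≠ q j := by
    refine ⟨w.bypass.getVert, w.bypass.length, Walk.getVert_zero _, Walk.getVert_length _,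
      fun i hi => Walk.adj_getVert_succ _ hi,
      fun i => hw _ (w.support_bypass_subset_support (Walk.getVert_mem_support _ i)),
      fun i j hij hj h => ?_⟩
    exact hij.ne (w.bypass_isPath.getVert_injOn (by simp; omega) (by simpa using hj) h)
  have hL : L ≠ 0 := by
    rintro rfl
    exact hmeet n (by omega) le_rfl (by rw [han, hbn, ← hq0, hqL])
  -- The cycle: from `a s` up to `x`, along `q` to `y`, down `b` to level `l`, and up `a` back to `a
  -- s`.
  let v : ℕ → V := fun t =>
    if t ≤ R then a (s + t) else
    if t ≤ R + L then q (t - R) else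
    if t ≤ R + L + (n - l) then b (n - (t - (R + L))) else
    a (l + (t - (R + L + (n - l))))
  have v1 : ∀ t ≤ R, v t = a (s + t) := fun t ht => if_pos ht
  have v2 : ∀ t ≤ L, v (R + t) = q t := by
    intro t ht
    rcases Nat.eq_zero_or_pos t with rfl | h
    · rw [Nat.add_zero, v1 _ le_rfl, hs, han, hq0]
    · simp only [v]
      rw [if_neg (by omega), if_pos (by omega), Nat.add_sub_cancel_left]
  have v3 : ∀ t ≤ n - l, v (R + L + t) = b (n - t) := by
    intro t ht
    rcases Nat.eq_zero_or_pos t with rfl | h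
    · rw [Nat.add_zero, v2 _ le_rfl, hqL, Nat.sub_zero, hbn]
    · simp only [v]
      rw [if_neg (by omega), if_neg (by omega), if_pos (by omega), Nat.add_sub_cancel_left]
  have v4 : ∀ t ≤ s - l, v (R + L + (n - l) + t) = a (l + t) := by
    intro t ht
    rcases Nat.eq_zero_or_pos t with rfl | h
    · rw [Nat.add_zero, v3 _ le_rfl, Nat.add_zero, hl, Nat.sub_sub_self (by omega)]
    · simp only [v]
      rw [if_neg (by omega), if_neg (by omega), if_neg (by omega), Nat.add_sub_cancel_left]
  have parts : ∀ t, t ≤ R ∨ (∃ e, t = R + e ∧ 0 < e ∧ e ≤ L) ∨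
      (∃ e, t = R + L + e ∧ 0 < e ∧ e ≤ n - l) ∨ ∃ e, t = R + L + (n - l) + e ∧ 0 < e := by
    intro t
    by_cases h1 : t ≤ R
    · exact .inl h1
    by_cases h2 : t ≤ R + L
    · exact .inr (.inl ⟨t - R, by omega, by omega, by omega⟩)
    by_cases h3 : t ≤ R + L + (n - l)
    · exact .inr (.inr (.inl ⟨t - (R + L), by omega, by omega, by omega⟩))
    · exact .inr (.inr (.inr ⟨t - (R + L + (n - l)), by omega, by omega⟩))
  clear_value v
  have hadj : ∀ t < R + L + (n - l) + (s - l), Γ.Adj (v t) (v (t + 1)) := by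
    intro t ht
    rcases lt_or_ge t R with h | h
    · rw [v1 t h.le, v1 (t + 1) h]
      exact haa _ (by omega)
    obtain ⟨t, rfl⟩ := Nat.exists_eq_add_of_le h
    rcases lt_or_ge t L with h | h
    · rw [v2 t h.le, add_assoc, v2 (t + 1) h]
      exact hqq _ h
    obtain ⟨t, rfl⟩ := Nat.exists_eq_add_of_le h
    rw [← add_assoc]
    rcases lt_or_ge t (n - l) with h | h
    · rw [v3 t h.le, add_assoc, v3 (t + 1) h]
      have := hbb (n - (t + 1)) (by omega)
      rw [show n - (t + 1) + 1 = n - t by omega] at this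
      exact this.symm
    obtain ⟨t, rfl⟩ := Nat.exists_eq_add_of_le h
    rw [← add_assoc, v4 t (by omega), add_assoc, v4 (t + 1) (by omega)]
    exact haa _ (by omega)
  have hclosed : v (R + L + (n - l) + (s - l)) = v 0 := by
    rw [v4 _ le_rfl, v1 0 (by omega)]
    congr 1
    omega
  -- Repetitions are excluded by level along each geodesic, by `hqinj` on `q`, and by `hlmax`
  -- between the geodesics; `q` meets the geodesics only at `x` and `y`.
  have hinj : ∀ t t', t < t' → t' < R + L + (n - l) + (s - l) → v t ≠ v t' := by
    intro t t' htt ht' heq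
    have hlev := congrArg (Γ.dist o) heq
    rcases parts t with h | ⟨e, rfl, h1, h2⟩ | ⟨e, rfl, h1, h2⟩ | ⟨e, rfl, h1⟩ <;>
      rcases parts t' with h' | ⟨e', rfl, h1', h2'⟩ | ⟨e', rfl, h1', h2'⟩ | ⟨e', rfl, h1'⟩ <;>
      try omega
    · rw [v1 t h, v1 t' h', ha _ (by omega), ha _ (by omega)] at hlev
      omega
    · rw [v1 t h, v2 e' h2', ha _ (by omega)] at hlev
      have := hq e'
      rw [v1 t h, v2 e' h2', show s + t = n by omega, han, ← hq0] at heq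
      exact hqinj _ _ h1' h2' heq
    · rw [v1 t h, v3 e' h2', ha _ (by omega), hb _ (by omega)] at hlev
      rw [v1 t h, v3 e' h2', ← hlev] at heq
      exact hlmax _ (by omega) (by omega) heq
    · rw [v1 t h, v4 e' (by omega), ha _ (by omega), ha _ (by omega)] at hlev
      omega
    · rw [v2 e h2, v2 e' h2'] at heq
      exact hqinj _ _ (by omega) h2' heq
    · rw [v2 e h2, v3 e' h2', hb _ (by omega)] at hlev
      have := hq e
      omega
    · rw [v2 e h2, v4 e' (by omega), ha _ (by omega)] at hlev
      have := hq e
      omega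
    · rw [v3 e h2, v3 e' h2', hb _ (by omega), hb _ (by omega)] at hlev
      omega
    · rw [v3 e h2, v4 e' (by omega), ha _ (by omega), hb _ (by omega)] at hlev
      rw [v3 e h2, v4 e' (by omega), hlev] at heq
      exact hlmax _ (by omega) (by omega) heq.symm
    · rw [v4 e (by omega), v4 e' (by omega), ha _ (by omega), ha _ (by omega)] at hlev
      omega
  obtain ⟨i, j, d, hi, hij, hj, hd, hdm, hdi, hdj⟩ :=
    hcut v (R + L + (n - l) + (s - l)) (by omega) (by omega) hadj hclosed hinj
  rw [v1 i (by omega)] at hd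
  have hai := ha (s + i) (by omega)
  have up := dist_root_le_add_dist hΓ o (a (s + i)) (v j)
  have down := dist_root_le_add_dist hΓ o (v j) (a (s + i))
  rw [hd, hai] at up
  rw [dist_comm (u := v j), hai, hd] at down
  -- A chord ending on `a` cannot beat an arc that is itself geodesic, and one ending on `q` would
  -- be longer than `m`. So it ends on `b`, at depth at most `R + m`, and the route through it
  -- bounds the distance from `x` to `y`.
  rcases parts j with h | ⟨e, rfl, h1, h2⟩ | ⟨e, rfl, h1, h2⟩ | ⟨e, rfl, h1⟩
  · rw [v1 j h, ha _ (by omega)] at up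
    omega
  · rw [v2 e h2] at up
    have := hq e
    omega
  · rw [v3 e h2] at hd down
    rw [hb _ (by omega)] at down
    have := close (s + i) (n - e) (by omega) (by omega)
    omega
  · rw [v4 e (by omega), ha _ (by omega)] at down
    omega

lemma IsChordal.exists_tree_groupQuasiIsometric {G : Type u} [Group G] {S : Set G}
    (hfin : S.Finite) (hgen : Subgroup.closure S = ⊤) {i₀ k m : ℕ} (hch : IsChordal S i₀ k m) :
    ∃ (T : Type v) (t : SimpleGraph T), t.IsTree ∧ (∀ x : T, (t.neighborSet x).Finite) ∧
      GroupQuasiIsometric G (GraphSpace t) := by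
  have hΓ := mulCayley_connected hgen
  obtain ⟨T, t, h1, h2, h3⟩ := exists_tree_quasiIsometric.{u, v} hΓ 1
    (mulCayley_neighborSet_finite hfin)
    (dist_le_of_exists_shortcut hΓ 1 fun v n => hch.exists_shortcut (v := v) (n := n))
  exact ⟨T, t, h1, h2, S, hfin, hgen, h3⟩

end Chordal

/-! ### Groups that are quasi-isometric to trees are chordal -/

namespace SimpleGraph

variable {T : Type*} {t : SimpleGraph T}

/-- A sequence with bounded jumps is followed by a walk. -/
lemma Connected.exists_walk_near (ht : t.Connected) (a : ℕ → T) {D p q : ℕ} (hpq : p ≤ q)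
    (ha : ∀ i, p ≤ i → i < q → t.dist (a i) (a (i + 1)) ≤ D) :
    ∃ w : t.Walk (a p) (a q), ∀ z ∈ w.support, ∃ i, p ≤ i ∧ i ≤ q ∧ t.dist z (a i) ≤ D := by
  classical
  induction q, hpq using Nat.le_induction with
  | base =>
    exact ⟨Walk.nil, fun z hz => ⟨p, le_rfl, le_rfl, by simp_all⟩⟩
  | succ q hpq ih =>
    obtain ⟨w, hw⟩ := ih fun i h1 h2 => ha i h1 (by omega)
    obtain ⟨w', hw'⟩ := ht.exists_walk_length_eq_dist (a q) (a (q + 1))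
    refine ⟨w.append w', fun z hz => ?_⟩
    rcases (Walk.mem_support_append_iff _ _).1 hz with hz | hz
    · obtain ⟨i, h1, h2, h3⟩ := hw z hz
      exact ⟨i, h1, by omega, h3⟩
    · refine ⟨q + 1, by omega, le_rfl, ?_⟩
      have h1 := dist_le (w'.dropUntil z hz)
      have h2 := w'.length_dropUntil_le_length hz
      have h3 := ha q hpq (by omega)
      omega

lemma IsAcyclic.mem_support_of_isPath (ht : t.IsAcyclic) {u v z : T} {p : t.Walk u v}
    (hp : p.IsPath) (hz : z ∈ p.support) (w : t.Walk u v) : z ∈ w.support := by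
  classical
  have h := (ht.subsingleton_path u v).elim ⟨p, hp⟩ ⟨w.bypass, w.bypass_isPath⟩
  exact w.support_bypass_subset_support (Subtype.mk.inj h ▸ hz)

/-- The vertex at distance `c` from `u` on the geodesic from `u` to `v` in a tree lies on every
walk from `u` to `v`. -/
lemma IsTree.exists_dist_le (ht : t.IsTree) {u v : T} {c : ℕ} (hc : c ≤ t.dist u v) :
    ∃ z, c ≤ t.dist u z ∧ t.dist u v ≤ t.dist v z + c ∧ ∀ w : t.Walk u v, z ∈ w.support := by
  classical
  obtain ⟨p, hp, hlen⟩ := ht.connected.exists_path_of_dist u v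
  have h1 := dist_le (p.take c)
  have h2 := dist_le (p.drop c)
  rw [Walk.take_length] at h1
  rw [Walk.drop_length] at h2
  have h3 := ht.connected.dist_triangle (u := u) (v := p.getVert c) (w := v)
  refine ⟨p.getVert c, by omega, ?_, ht.isAcyclic.mem_support_of_isPath hp
    (p.getVert_mem_support c)⟩
  rw [dist_comm (u := v)]
  omega

end SimpleGraph

open SimpleGraph

/-- A sequence in a graph that is coarsely a tree, and that returns to its start, has
a short shortcut near its start. -/
lemma exists_shortcut_of_map_to_tree {V T : Type*} {Γ : SimpleGraph V} {t : SimpleGraph T}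
    (ht : t.IsTree) {F : V → T} {D A B : ℕ}
    (hD : ∀ x y, Γ.Adj x y → t.dist (F x) (F y) ≤ D)
    (hAB : ∀ x y, Γ.dist x y ≤ A * t.dist (F x) (F y) + B) :
    ∃ k m : ℕ, ∀ (v : ℕ → V) (n : ℕ), k ≤ n → (∀ i < n, Γ.Adj (v i) (v (i + 1))) →
      v n = v 0 → ∃ i j : ℕ, i ≤ k ∧ i < j ∧ j < n ∧ Γ.dist (v i) (v j) ≤ m ∧
        Γ.dist (v i) (v j) + i + 1 ≤ j ∧ Γ.dist (v i) (v j) + j + 1 ≤ n + i := by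
  -- Vertices whose images lie within `D` of one tree vertex are at most `Δ` apart. Images at least
  -- `c - D` apart require more than `Δ + 1` steps. A geodesic of length `P` has image ends more
  -- than `2 * c` apart.
  obtain ⟨Δ, hΔ⟩ : ∃ Δ, Δ = A * (2 * D) + B := ⟨_, rfl⟩
  obtain ⟨c, hc⟩ : ∃ c, c = D * (Δ + 2) + 1 := ⟨_, rfl⟩
  obtain ⟨P, hP⟩ : ∃ P, P = A * (2 * c) + B + 1 := ⟨_, rfl⟩
  refine ⟨2 * P + 1, Δ + P, fun v n hn hadj hclosed => ?_⟩
  -- If the first `P` steps are not geodesic, their ends already give the chord.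
  by_cases hgeo : Γ.dist (v 0) (v P) < P
  · exact ⟨0, P, by omega, by omega, by omega, by omega, by omega, by omega⟩
  have hjump : ∀ i, i < n → t.dist (F (v i)) (F (v (i + 1))) ≤ D := fun i hi => hD _ _ (hadj i hi)
  have hlip : ∀ i j, i ≤ j → j ≤ n → t.dist (F (v i)) (F (v j)) ≤ D * (j - i) := by
    intro i j hij
    induction j, hij using Nat.le_induction with
    | base => simp
    | succ j hij ih =>
      intro hj
      have h1 := ht.connected.dist_triangle (u := F (v i)) (v := F (v j)) (w := F (v (j + 1)))
      have h2 := hjump j (by omega)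
      have h3 := ih (by omega)
      rw [Nat.succ_sub hij, Nat.mul_succ]
      omega
  have hM : 2 * c < t.dist (F (v 0)) (F (v P)) := by
    by_contra h
    have h1 := hAB (v 0) (v P)
    have h2 := Nat.mul_le_mul_left A (not_lt.1 h)
    omega
  -- `z` lies on every walk between the two images, so both the outgoing arc and the returning arc
  -- pass within `D` of it, at the indices `i` and `j`.
  obtain ⟨z, hz1, hz2, hz⟩ := ht.exists_dist_le (show c ≤ t.dist (F (v 0)) (F (v P)) by omega)
  obtain ⟨w₁, hw₁⟩ := ht.connected.exists_walk_near (fun i => F (v i)) (Nat.zero_le P)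
    fun i _ h2 => hjump i (by omega)
  obtain ⟨w₂, hw₂⟩ := ht.connected.exists_walk_near (fun i => F (v i)) (show P ≤ n by omega)
    fun i _ h2 => hjump i h2
  obtain ⟨i, -, hiP, hi⟩ := hw₁ z (hz w₁)
  obtain ⟨j, hjP, hjn, hj⟩ := hw₂ z (by
    have := hz (w₂.reverse.copy (by simp [hclosed]) rfl)
    simpa using this)
  have hij : Γ.dist (v i) (v j) ≤ Δ := by
    have h1 := hAB (v i) (v j)
    have h2 := ht.connected.dist_triangle (u := F (v i)) (v := z) (w := F (v j))
    rw [SimpleGraph.dist_comm (u := F (v i)) (v := z)] at h2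
    have h3 := Nat.mul_le_mul_left A (show t.dist (F (v i)) (F (v j)) ≤ 2 * D by omega)
    omega
  have hi1 : Δ + 1 < i := by
    have h1 := ht.connected.dist_triangle (u := F (v 0)) (v := F (v i)) (w := z)
    rw [SimpleGraph.dist_comm (u := F (v i)) (v := z)] at h1
    have h2 := hlip 0 i (Nat.zero_le i) (by omega)
    by_contra h
    have h3 := Nat.mul_le_mul_left D (show i - 0 ≤ Δ + 1 by omega)
    rw [Nat.mul_add] at hc h3
    omega
  have hi2 : Δ + 1 < P - i := by
    have h1 := ht.connected.dist_triangle (u := F (v P)) (v := F (v i)) (w := z)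
    rw [SimpleGraph.dist_comm (u := F (v i)) (v := z),
      SimpleGraph.dist_comm (u := F (v P)) (v := F (v i))] at h1
    have h2 := hlip i P hiP (by omega)
    by_contra h
    have h3 := Nat.mul_le_mul_left D (show P - i ≤ Δ + 1 by omega)
    rw [Nat.mul_add] at hc h3
    omega
  -- For `j = n` the tree vertex `z` would be within `D` of the image of `v 0`, but it is at
  -- distance at least `c`, which exceeds `D`.
  by_cases hjn' : j = n
  · subst hjn'
    rw [hclosed, SimpleGraph.dist_comm] at hj
    have h1 := Nat.le_mul_of_pos_right D (show 0 < Δ + 2 by omega)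
    omega
  exact ⟨i, j, by omega, by omega, by omega, by omega, by omega, by omega⟩

lemma isChordal_of_map_to_tree {G : Type*} [Group G] {S : Set G}
    (hgen : Subgroup.closure S = ⊤) {T : Type*} {t : SimpleGraph T} (ht : t.IsTree)
    {F : G → T} {D A B : ℕ} (hD : ∀ x y, (mulCayley S).Adj x y → t.dist (F x) (F y) ≤ D)
    (hAB : ∀ x y, (mulCayley S).dist x y ≤ A * t.dist (F x) (F y) + B) :
    ∃ i₀ k m, IsChordal S i₀ k m := by
  obtain ⟨k, m, h⟩ := exists_shortcut_of_map_to_tree ht hD hAB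
  refine ⟨k + 1, k, m, fun w hw hk => ?_⟩
  have hadj : ∀ i < w.length,
      (mulCayley S).Adj (w.take i).prod (w.take (i + 1)).prod := by
    intro i hi
    rw [mulCayley_adj_iff, List.prod_take_succ _ _ hi, inv_mul_cancel_left]
    exact hw.2.1 _ (List.getElem_mem hi)
  have hclosed : (w.take w.length).prod = (w.take 0).prod := by
    have := (hw.2.2 1 w.length le_rfl (by have := hw.1; omega) le_rfl).2 ⟨rfl, rfl⟩
    simpa [segmentProd] using this
  obtain ⟨i, j, hi, hij, hj, hm, h1, h2⟩ :=
    h (fun i => (w.take i).prod) w.length hk hadj hclosed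
  obtain ⟨w', hw', hprod, hlen⟩ :=
    exists_word_of_dist hgen (w.take i).prod (w.take j).prod
  have hseg : segmentProd w (i + 1) j = w'.prod := by
    rw [segmentProd_eq_inv_mul w (by omega), ← hprod, Nat.add_sub_cancel]
  refine ⟨i + 1, j, by omega, by omega, ?_, hj.le, w', hw', hseg, ?_⟩
  -- For `j = i + 1` the chord would have length 0, so a single letter would be trivial, contrary to
  -- simplicity.
  · by_contra hne
    obtain rfl : j = i + 1 := by omega
    have h0 : (mulCayley S).dist (w.take i).prod (w.take (i + 1)).prod = 0 := by omega
    have := (hw.2.2 (i + 1) (i + 1) (by omega) le_rfl hj.le).1 (by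
      rw [hseg, List.length_eq_zero_iff.1 (hlen.trans h0), List.prod_nil])
    omega
  · push_cast
    omega

/-- The quasi-isometry may use a generating set other than `S`; comparing the two word metrics
changes the constants of the vertex map only by factors. -/
lemma GroupQuasiIsometric.exists_isChordal {G : Type*} [Group G] {S : Set G}
    (hfin : S.Finite) (hgen : Subgroup.closure S = ⊤) {T : Type*} {t : SimpleGraph T}
    (ht : t.IsTree) (h : GroupQuasiIsometric G (GraphSpace t)) :
    ∃ i₀ k m, IsChordal S i₀ k m := by
  obtain ⟨S', hfin', hgen', f, hf, -⟩ := h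
  obtain ⟨F, D, A, B, hD, hAB⟩ :=
    GraphSpace.exists_vertex_map (mulCayley_connected hgen') ht.connected hf
  obtain ⟨C, hC⟩ := exists_mulCayley_dist_le hgen hfin' hgen'
  obtain ⟨C', hC'⟩ := exists_mulCayley_dist_le hgen' hfin hgen
  refine isChordal_of_map_to_tree hgen ht (F := F) (D := D * C') (A := C * A) (B := C * B)
    (fun x y hxy => ?_) fun x y => ?_
  · have h1 := hC' x y
    rw [dist_eq_one_iff_adj.2 hxy, mul_one] at h1
    exact (dist_le_mul_of_adj (mulCayley_connected hgen') ht.connected F hD x y).trans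
      (Nat.mul_le_mul_left D h1)
  · calc _ ≤ C * (mulCayley S').dist x y := hC x y
      _ ≤ C * (A * t.dist (F x) (F y) + B) := Nat.mul_le_mul_left C (hAB x y)
      _ = _ := by ring

theorem corollary4p9 {G : Type u} [Group G] (S : Set G) (hfin : S.Finite)
    (hgen : Subgroup.closure S = ⊤) :
    ((∃ (T : Type v) (t : SimpleGraph T), t.IsTree ∧ GroupQuasiIsometric G (GraphSpace t)) ↔
      ∃ i₀ k m : ℕ, IsChordal S i₀ k m) ∧
    ((∃ i₀ k m : ℕ, IsChordal S i₀ k m) →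
      ∃ (T : Type v) (t : SimpleGraph T), t.IsTree ∧ (∀ x : T, (t.neighborSet x).Finite) ∧
        GroupQuasiIsometric G (GraphSpace t)) := by
  have tree : (∃ i₀ k m : ℕ, IsChordal S i₀ k m) →
      ∃ (T : Type v) (t : SimpleGraph T), t.IsTree ∧ (∀ x : T, (t.neighborSet x).Finite) ∧
        GroupQuasiIsometric G (GraphSpace t) := by
    rintro ⟨i₀, k, m, h⟩
    exact h.exists_tree_groupQuasiIsometric hfin hgen
  refine ⟨⟨?_, fun h => ?_⟩, tree⟩
  · rintro ⟨T, t, ht, h⟩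
    exact h.exists_isChordal hfin hgen ht
  · obtain ⟨T, t, ht, -, h⟩ := tree h
    exact ⟨T, t, ht, h⟩
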